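/- **Corollary 4.3.** Let $m\ge n\ge 2$, let $\Omega$ be a domain (nonempty, open, connected) in $\mathbb R^{m+n}=\mathbb R^m\times\mathbb R^n$, and let $K\ge 1$. *Terminology.* Let $D\subset\mathbb R^N$ be open, let $m_N$ be Lebesgue measure on $\mathbb R^N$ and $\nu_N=m_N(B^N(0,1))$, and write $w^+=\max\{w,0\}$. A Lebesgue measurable function $w:D\to[-\infty,+\infty)$ is called *$K$-quasi-nearly subharmonic* if $w^+\in L^1_{\rm loc}(D)$ and, for every closed ball $\overline{B^N(x,r)}\subset D$ (with $r>0$) and every real $M\ge 0$, $$w_M(x)\le \frac{K}{\nu_N r^N}\int_{B^N(x,r)} w_M(y)\,dm_N(y),\qquad\text{where } w_M:=\max\{w,-M\}+M .$$ It is called *quasi-nearly subharmonic* if it is $K'$-quasi-nearly subharmonic for some constant $K'\ge 1$. For $y\in\mathbb R^n$ and $x\in\mathbb R^m$ put $\Omega(y)=\{x\in\mathbb R^m:(x,y)\in\Omega\}$ and $\Omega(x)=\{y\in\mathbb R^n:(x,y)\in\Omega\}$; these are open sets, possibly empty or disconnected. *Statement.* Let $u:\Omega\to[-\infty,+\infty)$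 be a Lebesgue measurable function such that: (a) for each $y\in\mathbb R^n$ the function $\Omega(y)\ni x\mapsto u(x,y)$ is $K$-quasi-nearly subharmonic; (b) for each $x\in\mathbb R^m$ the function $\Omega(x)\ni y\mapsto u(x,y)$ is $K$-quasi-nearly subharmonic; (c) there is a strictly increasing surjection $\varphi:[0,+\infty)\to[0,+\infty)$ such that (c1) $\displaystyle\int_{s_0+1}^{+\infty}\frac{s^{(n-1)/(m-1)}}{\varphi(s-s_0)^{1/(m-1)}}\,ds<+\infty$ for some $s_0\in\mathbb N$ (where $0\in\mathbb N$), and (c2) $\varphi(\log^+u^+)\in L^1_{\rm loc}(\Omega)$, where $\log^+t=\max\{\log t,0\}$ for $t>0$ and $\log^+0=0$. Then $u$ is quasi-nearly subharmonic in $\Omega$. -/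

import Mathlib

open Set MeasureTheory

noncomputable section

/-- `u⁺ = max {u, 0}` as a real number; used where `u < +∞`. -/
def uPlus (t : EReal) : ℝ := (max t 0).toReal

/-- `u_M = max {u, -M} + M` as a (nonnegative) real number; used where `u < +∞`
(the maximum is then finite, as it is at least `-M`). -/
def uTrunc (M : ℝ) (t : EReal) : ℝ := (max t ((-M : ℝ) : EReal)).toReal + M

/-- `u : D → [-∞, +∞)` is `K`-quasi-nearly subharmonic on the set `D ⊆ ℝ^N` (meant for open `D`).
The function is given on all of `ℝ^N`, but only its values on `D` matter. -/
structure IsKQuasiNearlySubharmonic {N : ℕ} (K : ℝ)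
    (u : EuclideanSpace ℝ (Fin N) → EReal) (D : Set (EuclideanSpace ℝ (Fin N))) : Prop where
  one_le : 1 ≤ K
  lt_top : ∀ x ∈ D, u x < ⊤
  /-- `u` is Lebesgue measurable on `D`. -/
  measurable : NullMeasurable u (volume.restrict D)
  /-- `u⁺` is locally integrable in `D`. -/
  locallyIntegrable : LocallyIntegrableOn (fun x => uPlus (u x)) D volume
  /-- `u_M` satisfies the generalized mean value inequality on every closed ball in `D`. -/
  mean_value : ∀ (x : EuclideanSpace ℝ (Fin N)) (r : ℝ), 0 < r → Metric.closedBall x r ⊆ D →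
    ∀ M : ℝ, 0 ≤ M →
      uTrunc M (u x) ≤
        K / (volume.real (Metric.ball (0 : EuclideanSpace ℝ (Fin N)) 1) * r ^ N) *
          ∫ y in Metric.ball x r, uTrunc M (u y)

/-- `u` is quasi-nearly subharmonic on `D`: it is `K`-quasi-nearly subharmonic for some `K ≥ 1`. -/
def IsQuasiNearlySubharmonic {N : ℕ}
    (u : EuclideanSpace ℝ (Fin N) → EReal) (D : Set (EuclideanSpace ℝ (Fin N))) : Prop :=
  ∃ K : ℝ, IsKQuasiNearlySubharmonic K u D

/-- The point `(x, y)` of `ℝ^{m+n}`, for `x ∈ ℝ^m` and `y ∈ ℝ^n`. -/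
def joinPt {m n : ℕ} (x : EuclideanSpace ℝ (Fin m)) (y : EuclideanSpace ℝ (Fin n)) :
    EuclideanSpace ℝ (Fin (m + n)) :=
  WithLp.toLp 2 (Fin.append x.ofLp y.ofLp)

end

open scoped ENNReal

/-! Once `u⁺` is locally bounded it is locally integrable, and the mean value inequalities in `x`
and in `y` can be iterated over a product of balls inside a given ball; comparing volumes gives the
joint inequality. So everything rests on a local upper bound for `v = u⁺`, obtained by applying
Domar's method twice.

Let `v` satisfy the mean value inequality with constant `K` in `ℝ^N`, put `A = 4K`, and let `v(x) ≥
A^(i+1)`. If `v < A^(i+2)` on a ball about `x`, the band `A^i ≤ v < A^(i+2)` fills at least a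
fraction `A^(-2)` of that ball. A ball too large for this contains a point of the next level. Since
`v` is bounded on slices (no uniformity is needed), the resulting chain must leave the ball of
radius `R`, so `R` is at most a sum of lengths of order `|band|^(1/N)`
(`SubMeanValue.le_sum_radii`). If `1 ≤ a_i^(N-1) G` where `v ≥ A^i`, Hölder's inequality turns this
into `|B_R| ≤ C (∑_{i ≥ j} a_i)^(N-1) ∫ G` (`SubMeanValue.volume_ball_le_of_levels`).

In `y`, with `x` fixed, take `a_i = φ(i+2)^(-1/(n-1))`, up to an index shift, and `G = φ(log⁺ u⁺)`.
A large value on the slice then forces `f(x) = ∫ G dy` to be at least a constant times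
`T_J^(-(n-1))`, where `T_J` is a tail of `∑ a_i`. This is again a level-set majorant, now in `x`,
with weights `T_J^θ`, `θ = (n-1)/(m-1)`. If `∑ T_J^θ` converges, its tails tend to `0`, and the
second application excludes high levels. Since `θ ≤ 1`, `∑ T_j^θ ≤ θ⁻¹ ∑ (k+1)^θ a_k^θ`
(`tsum_tail_rpow_le_of_antitone`), which the integral condition on `φ` makes finite. -/

/-! ### Powers of tails of decreasing series, and the weight condition -/

/-- Bernoulli's inequality for the concave power `θ`, at `-1/(n+1)`, gives `θ (n+1)^(θ-1) ≤ (n+1)^θ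
- n^θ`, which telescopes. -/
theorem sum_rpow_sub_one_le {θ : ℝ} (h0 : 0 < θ) (h1 : θ ≤ 1) (n : ℕ) :
    ∑ i ∈ Finset.range n, ((i : ℝ) + 1) ^ (θ - 1) ≤ (n : ℝ) ^ θ / θ := by
  induction n with
  | zero => simp [Real.zero_rpow h0.ne']
  | succ n ih =>
    rw [Finset.sum_range_succ]
    have hn : (0 : ℝ) < n + 1 := by positivity
    have hb := rpow_one_add_le_one_add_mul_self (s := -1 / ((n : ℝ) + 1))
      (by rw [le_div_iff₀ hn]; linarith [(Nat.cast_nonneg n : (0 : ℝ) ≤ n)]) h0.le h1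
    have e : 1 + -1 / ((n : ℝ) + 1) = n / (n + 1) := by field_simp; ring
    rw [e, Real.div_rpow (Nat.cast_nonneg n) hn.le, div_le_iff₀ (by positivity)] at hb
    have e2 : ((n : ℝ) + 1) ^ (θ - 1) = (n + 1 : ℝ) ^ θ / (n + 1) := by
      rw [Real.rpow_sub hn, Real.rpow_one]
    have e3 : (1 + θ * (-1 / ((n : ℝ) + 1))) * (n + 1 : ℝ) ^ θ =
        (n + 1 : ℝ) ^ θ - θ * ((n + 1 : ℝ) ^ θ / (n + 1)) := by ring
    rw [e3] at hb
    push_cast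
    rw [e2]
    rw [le_div_iff₀ h0] at ih ⊢
    linarith

/-- With partial sums `s` and `t = s + a n`, write `t^θ = s t^(θ-1) + a_n t^(θ-1)`. As `θ - 1 ≤ 0`,
the first term is at most `s^θ`; monotonicity of `a` gives `t ≥ (n+1) a_n`, which bounds the second.
-/
theorem sum_rpow_le_of_antitone {θ : ℝ} (h0 : 0 < θ) (h1 : θ ≤ 1) {a : ℕ → ℝ}
    (ha : ∀ i, 0 < a i) (hanti : Antitone a) (n : ℕ) :
    (∑ i ∈ Finset.range n, a i) ^ θ ≤
      ∑ i ∈ Finset.range n, ((i : ℝ) + 1) ^ (θ - 1) * a i ^ θ := by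
  induction n with
  | zero => simp [Real.zero_rpow h0.ne']
  | succ n ih =>
    rw [Finset.sum_range_succ (fun i => ((i : ℝ) + 1) ^ (θ - 1) * a i ^ θ)]
    set s := ∑ i ∈ Finset.range n, a i with hs
    set t := ∑ i ∈ Finset.range (n + 1), a i with ht
    have hts : t = s + a n := Finset.sum_range_succ _ _
    have hs0 : 0 ≤ s := Finset.sum_nonneg fun i _ => (ha i).le
    have hn : (0 : ℝ) < n + 1 := by positivity
    have ht0 : 0 < t := by have := ha n; linarith
    have hlow : ((n : ℝ) + 1) * a n ≤ t := by
      have := Finset.card_nsmul_le_sum (Finset.range (n + 1)) a (a n)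
        (fun i hi => hanti (by simpa [Nat.lt_succ_iff] using hi))
      simpa using this
    have e1 : t ^ θ = s * t ^ (θ - 1) + a n * t ^ (θ - 1) := by
      rw [← add_mul, ← hts, Real.rpow_sub ht0, Real.rpow_one]; field_simp
    have e2 : s * t ^ (θ - 1) ≤ s ^ θ := by
      rcases hs0.eq_or_lt with h | h
      · rw [← h]; simp [Real.zero_rpow h0.ne']
      · have : t ^ (θ - 1) ≤ s ^ (θ - 1) :=
          Real.rpow_le_rpow_of_nonpos h (by linarith [ha n]) (by linarith)
        calc s * t ^ (θ - 1) ≤ s * s ^ (θ - 1) := by gcongr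
          _ = s ^ θ := by rw [Real.rpow_sub h, Real.rpow_one]; field_simp
    have e3 : a n * t ^ (θ - 1) ≤ ((n : ℝ) + 1) ^ (θ - 1) * a n ^ θ := by
      have hp : 0 < a n := ha n
      have : t ^ (θ - 1) ≤ (((n : ℝ) + 1) * a n) ^ (θ - 1) :=
        Real.rpow_le_rpow_of_nonpos (by positivity) hlow (by linarith)
      calc a n * t ^ (θ - 1) ≤ a n * (((n : ℝ) + 1) * a n) ^ (θ - 1) := by gcongr
        _ = ((n : ℝ) + 1) ^ (θ - 1) * a n ^ θ := by
          rw [Real.mul_rpow hn.le hp.le, Real.rpow_sub hp, Real.rpow_one]; field_simp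
    linarith

theorem tsum_ofReal_rpow_le_of_antitone {θ : ℝ} (h0 : 0 < θ) (h1 : θ ≤ 1) {a : ℕ → ℝ}
    (ha : ∀ i, 0 < a i) (hanti : Antitone a) :
    (∑' i, ENNReal.ofReal (a i)) ^ θ ≤
      ∑' i : ℕ, ENNReal.ofReal (((i : ℝ) + 1) ^ (θ - 1) * a i ^ θ) := by
  have hlim := ((ENNReal.continuous_rpow_const (y := θ)).tendsto _).comp
    (ENNReal.tendsto_nat_tsum fun i => ENNReal.ofReal (a i))
  refine le_of_tendsto hlim (.of_forall fun n => ?_)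
  refine le_trans ?_ (ENNReal.sum_le_tsum (Finset.range n))
  rw [← ENNReal.ofReal_sum_of_nonneg fun (i : ℕ) _ => by have := ha i; positivity]
  simp only [Function.comp]
  rw [← ENNReal.ofReal_sum_of_nonneg fun i _ => (ha i).le,
    ENNReal.ofReal_rpow_of_nonneg (Finset.sum_nonneg fun i _ => (ha i).le) h0.le]
  exact ENNReal.ofReal_le_ofReal (sum_rpow_le_of_antitone h0 h1 ha hanti n)

/-- Expanding each tail by the previous bound and grouping the double sum by `k = j + i`, the factor
`a_k^θ` is constant on each antidiagonal, and the remaining weights `(i+1)^(θ-1)` sum to at most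
`(k+1)^θ / θ`. -/
theorem tsum_tail_rpow_le_of_antitone {θ : ℝ} (h0 : 0 < θ) (h1 : θ ≤ 1) {a : ℕ → ℝ}
    (ha : ∀ i, 0 < a i) (hanti : Antitone a) :
    ∑' j, (∑' i, ENNReal.ofReal (a (j + i))) ^ θ ≤
      ENNReal.ofReal θ⁻¹ * ∑' k : ℕ, ENNReal.ofReal (((k : ℝ) + 1) ^ θ * a k ^ θ) := by
  calc ∑' j, (∑' i, ENNReal.ofReal (a (j + i))) ^ θ
      ≤ ∑' j, ∑' i : ℕ, ENNReal.ofReal (((i : ℝ) + 1) ^ (θ - 1) * a (j + i) ^ θ) :=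
        ENNReal.tsum_le_tsum fun j =>
          tsum_ofReal_rpow_le_of_antitone h0 h1 (fun i => ha _) fun i k h => hanti (by omega)
    _ = ∑' p : ℕ × ℕ, ENNReal.ofReal (((p.2 : ℝ) + 1) ^ (θ - 1) * a (p.1 + p.2) ^ θ) :=
        (ENNReal.tsum_prod (f := fun j i : ℕ =>
          ENNReal.ofReal (((i : ℝ) + 1) ^ (θ - 1) * a (j + i) ^ θ))).symm
    _ = ∑' s : (Σ k : ℕ, Finset.HasAntidiagonal.antidiagonal k),
          ENNReal.ofReal (((s.2.1.2 : ℝ) + 1) ^ (θ - 1) * a (s.2.1.1 + s.2.1.2) ^ θ) :=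
        (Finset.HasAntidiagonal.sigmaAntidiagonalEquivProd.tsum_eq
          (fun p : ℕ × ℕ => ENNReal.ofReal (((p.2 : ℝ) + 1) ^ (θ - 1) * a (p.1 + p.2) ^ θ))).symm
    _ = ∑' k : ℕ, ∑ p ∈ Finset.HasAntidiagonal.antidiagonal k,
          ENNReal.ofReal (((p.2 : ℝ) + 1) ^ (θ - 1) * a (p.1 + p.2) ^ θ) := by
        rw [ENNReal.tsum_sigma']
        refine tsum_congr fun k => ?_
        rw [tsum_fintype]
        exact Finset.sum_coe_sort (Finset.HasAntidiagonal.antidiagonal k) fun p : ℕ × ℕ =>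
          ENNReal.ofReal (((p.2 : ℝ) + 1) ^ (θ - 1) * a (p.1 + p.2) ^ θ)
    _ ≤ ∑' k : ℕ, ENNReal.ofReal θ⁻¹ * ENNReal.ofReal (((k : ℝ) + 1) ^ θ * a k ^ θ) := by
        refine ENNReal.tsum_le_tsum fun k => ?_
        have hk : 0 < a k := ha k
        rw [← ENNReal.ofReal_mul (by positivity),
          ← ENNReal.ofReal_sum_of_nonneg fun p _ => by
            have := ha (p.1 + p.2); positivity]
        refine ENNReal.ofReal_le_ofReal ?_
        have e : ∑ p ∈ Finset.HasAntidiagonal.antidiagonal k, ((p.2 : ℝ) + 1) ^ (θ - 1) * a (p.1 + p.2) ^ θ =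
            (∑ p ∈ Finset.HasAntidiagonal.antidiagonal k, ((p.2 : ℝ) + 1) ^ (θ - 1)) * a k ^ θ := by
          rw [Finset.sum_mul]
          refine Finset.sum_congr rfl fun p hp => ?_
          rw [Finset.HasAntidiagonal.mem_antidiagonal.mp hp]
        rw [e, ← Finset.Nat.sum_antidiagonal_swap,
          Finset.Nat.sum_antidiagonal_eq_sum_range_succ_mk]
        have := sum_rpow_sub_one_le h0 h1 (k + 1)
        push_cast at this
        simp only [Prod.snd_swap]
        calc _ ≤ ((k : ℝ) + 1) ^ θ / θ * a k ^ θ := by gcongr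
          _ = _ := by ring
    _ = _ := ENNReal.tsum_mul_left

/-- The weight condition on `φ`, discretized: the tails of `∑ φ(k)^{-1/(n-1)}`, raised to the
power `(n-1)/(m-1)`, are summable. -/
theorem tsum_tail_rpow_ne_top {p q : ℝ} (hp : 0 < p) (hpq : p ≤ q) {φ : ℝ → ℝ}
    (hmono : MonotoneOn φ (Ici 0)) (hpos : ∀ s, 0 < s → 0 < φ s) (s₀ : ℕ)
    (hint : IntegrableOn (fun s : ℝ => s ^ (p / q) / φ (s - s₀) ^ (1 / q))
      (Ioi ((s₀ : ℝ) + 1)) volume) :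
    ∑' j : ℕ, (∑' i : ℕ, ENNReal.ofReal (φ ((j + i : ℕ) + 2) ^ (-(1 / p)))) ^ (p / q) ≠ ∞ := by
  have hq : 0 < q := hp.trans_le hpq
  have hθ0 : 0 < p / q := div_pos hp hq
  have hθ1 : p / q ≤ 1 := (div_le_one hq).2 hpq
  have hφ (k : ℕ) : 0 < φ (k + 2) := hpos _ (by positivity)
  refine ne_top_of_le_ne_top ?_ (tsum_tail_rpow_le_of_antitone hθ0 hθ1
    (a := fun k : ℕ => φ (k + 2) ^ (-(1 / p))) (fun k => Real.rpow_pos_of_pos (hφ k) _) ?_)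
  swap
  · intro i k hik
    refine Real.rpow_le_rpow_of_nonpos (hφ i) ?_ (by simp [hp.le])
    have : (i : ℝ) ≤ k := by exact_mod_cast hik
    exact hmono (by simp; positivity) (by simp; positivity) (by linarith)
  refine ENNReal.mul_ne_top ENNReal.ofReal_ne_top ?_
  set F : ℝ → ℝ := fun s => s ^ (p / q) / φ (s - s₀) ^ (1 / q) with hF
  have hfin : ∫⁻ s in Ioi ((s₀ : ℝ) + 1), ENNReal.ofReal (F s) ≠ ∞ := by
    have := hint.2
    rw [HasFiniteIntegral] at this
    refine ne_top_of_le_ne_top this.ne (lintegral_mono fun s => ?_)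
    rw [← ofReal_norm]
    exact ENNReal.ofReal_le_ofReal (le_abs_self _)
  -- On these disjoint unit intervals `k + 1 ≤ s` and `s - s₀ ≤ k + 2`, so `F s` dominates the
  -- `k`-th term of the series. The factor `2^(p/q)` below is slack.
  set I : ℕ → Set ℝ := fun k => Ioc ((s₀ : ℝ) + 1 + k) (s₀ + 1 + (k + 1)) with hI
  have hdisj : Pairwise (Function.onFun Disjoint I) := by
    have := pairwise_disjoint_Ioc_add_intCast ((s₀ : ℝ) + 1)
    intro i k hik
    have h := this (i := (i : ℤ)) (j := (k : ℤ)) (by exact_mod_cast hik)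
    simpa [I, Function.onFun, add_assoc] using h
  have hsum : ∑' k, ∫⁻ s in I k, ENNReal.ofReal (F s) ≠ ∞ := by
    rw [← lintegral_iUnion (fun k => measurableSet_Ioc) hdisj]
    refine ne_top_of_le_ne_top hfin (lintegral_mono_set (iUnion_subset fun k s hs => ?_))
    have : (0 : ℝ) ≤ k := by positivity
    simp only [mem_Ioc, mem_Ioi] at hs ⊢
    linarith
  refine ne_top_of_le_ne_top
    (ENNReal.mul_ne_top (ENNReal.ofReal_ne_top (r := 2 ^ (p / q))) hsum) ?_
  rw [← ENNReal.tsum_mul_left]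
  refine ENNReal.tsum_le_tsum fun k => ?_
  set c : ℝ := ((k : ℝ) + 1) ^ (p / q) * (φ (k + 2) ^ (-(1 / p))) ^ (p / q) with hc
  have hvol : volume (I k) = 1 := by simp [I]
  calc ENNReal.ofReal c = ∫⁻ s in I k, ENNReal.ofReal c := by simp [hvol]
    _ ≤ ∫⁻ s in I k, ENNReal.ofReal (2 ^ (p / q)) * ENNReal.ofReal (F s) := by
      refine setLIntegral_mono' measurableSet_Ioc fun s hs => ?_
      rw [← ENNReal.ofReal_mul (by positivity)]
      refine ENNReal.ofReal_le_ofReal ?_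
      have hk : (0 : ℝ) ≤ k := by positivity
      have hs₀ : (0 : ℝ) ≤ s₀ := by positivity
      simp only [I, mem_Ioc] at hs
      have h1 : (φ (k + 2) ^ (-(1 / p))) ^ (p / q) = (φ (k + 2) ^ (1 / q))⁻¹ := by
        rw [← Real.rpow_mul (hφ k).le, ← Real.rpow_neg (hφ k).le]
        congr 1; field_simp
      have h2 : φ (s - s₀) ≤ φ (k + 2) :=
        hmono (by simp; linarith) (by simp; positivity) (by linarith)
      have h3 : 0 < φ (s - s₀) := hpos _ (by linarith)
      have h4 : 0 < s := by linarith
      have h5 := hφ k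
      have h6 : ((k : ℝ) + 1) ^ (p / q) ≤ s ^ (p / q) := by
        apply Real.rpow_le_rpow <;> first | positivity | linarith
      have h7 : (1 : ℝ) ≤ 2 ^ (p / q) := Real.one_le_rpow (by norm_num) hθ0.le
      rw [hc, h1]
      calc ((k : ℝ) + 1) ^ (p / q) * (φ (k + 2) ^ (1 / q))⁻¹
          ≤ s ^ (p / q) * (φ (s - s₀) ^ (1 / q))⁻¹ := by gcongr
        _ = 1 * F s := by simp [F, div_eq_mul_inv]
        _ ≤ 2 ^ (p / q) * F s := by gcongr
    _ = _ := lintegral_const_mul' _ _ ENNReal.ofReal_ne_top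

/-! ### The mean value inequality and Domar's estimate -/

/-- The generalized mean value inequality on balls, for `[0, ∞]`-valued functions. -/
def SubMeanValue {N : ℕ} (K : ℝ≥0∞) (w : EuclideanSpace ℝ (Fin N) → ℝ≥0∞)
    (D : Set (EuclideanSpace ℝ (Fin N))) : Prop :=
  ∀ (x : EuclideanSpace ℝ (Fin N)) (r : ℝ), 0 < r → Metric.closedBall x r ⊆ D →
    w x * volume (Metric.ball x r) ≤ K * ∫⁻ y in Metric.ball x r, w y

theorem SubMeanValue.mono {N : ℕ} {K : ℝ≥0∞} {w : EuclideanSpace ℝ (Fin N) → ℝ≥0∞}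
    {D D' : Set (EuclideanSpace ℝ (Fin N))} (h : SubMeanValue K w D) (hD : D' ⊆ D) :
    SubMeanValue K w D' :=
  fun x r hr hx => h x r hr (hx.trans hD)

theorem volume_ball_eq_ofReal_pow_mul {N : ℕ} (x : EuclideanSpace ℝ (Fin N)) {r : ℝ} (hr : 0 < r) :
    volume (Metric.ball x r) =
      ENNReal.ofReal r ^ N * volume (Metric.ball (0 : EuclideanSpace ℝ (Fin N)) 1) := by
  have := Measure.addHaar_ball_mul_of_pos (volume : Measure (EuclideanSpace ℝ (Fin N))) x hr 1
  rw [mul_one, finrank_euclideanSpace_fin, ENNReal.ofReal_pow hr.le] at this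
  exact this

/-- A function with the mean value property on `D` is bounded on balls well inside `D`. -/
theorem SubMeanValue.exists_bound {N : ℕ} {K : ℝ≥0∞} {w : EuclideanSpace ℝ (Fin N) → ℝ≥0∞}
    {D : Set (EuclideanSpace ℝ (Fin N))} (h : SubMeanValue K w D) (hK : K ≠ ∞)
    {x₀ : EuclideanSpace ℝ (Fin N)} {R R' : ℝ} (hR : R < R')
    (hD : Metric.closedBall x₀ R' ⊆ D) (hint : ∫⁻ y in Metric.closedBall x₀ R', w y ≠ ∞) :
    ∃ C : ℝ≥0∞, C ≠ ∞ ∧ ∀ x ∈ Metric.ball x₀ R, w x ≤ C := by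
  have hr : 0 < R' - R := by linarith
  set V := volume (Metric.ball x₀ (R' - R)) with hV
  have hV0 : V ≠ 0 := (Metric.measure_ball_pos _ _ hr).ne'
  have hVt : V ≠ ∞ := measure_ball_lt_top.ne
  refine ⟨K * (∫⁻ y in Metric.closedBall x₀ R', w y) / V,
    ENNReal.div_ne_top (ENNReal.mul_ne_top hK hint) hV0, fun x hx => ?_⟩
  have hsub : Metric.closedBall x (R' - R) ⊆ Metric.closedBall x₀ R' :=
    Metric.closedBall_subset_closedBall' (by rw [Metric.mem_ball] at hx; linarith)
  have h1 := h x _ hr (hsub.trans hD)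
  rw [ENNReal.le_div_iff_mul_le (.inl hV0) (.inl hVt)]
  -- The volume of a ball depends only on its radius, so the centre may be moved to `x₀`.
  rw [volume_ball_eq_ofReal_pow_mul _ hr, ← volume_ball_eq_ofReal_pow_mul x₀ hr] at h1
  exact h1.trans (mul_le_mul_right (lintegral_mono_set
    (Metric.ball_subset_closedBall.trans hsub)) _)

/-- If `w` at the centre reaches the level `A^{i+1}` but stays below `A^{i+2}` on the ball, then
the set where `w` lies between `A^i` and `A^{i+2}` is a fixed proportion of the ball. -/
theorem SubMeanValue.volume_ball_le {N : ℕ} {K : ℝ≥0∞} {w : EuclideanSpace ℝ (Fin N) → ℝ≥0∞}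
    {D : Set (EuclideanSpace ℝ (Fin N))} (h : SubMeanValue K w D) (hK1 : 1 ≤ K) (hK : K ≠ ∞)
    {x : EuclideanSpace ℝ (Fin N)} {r : ℝ} (hr : 0 < r) (hx : Metric.closedBall x r ⊆ D) {i : ℕ}
    (hwx : (4 * K) ^ (i + 1) ≤ w x) (hw : ∀ y ∈ Metric.ball x r, w y < (4 * K) ^ (i + 2)) :
    volume (Metric.ball x r) ≤ (4 * K) ^ 2 *
      volume (Metric.ball x r ∩ {y | (4 * K) ^ i ≤ w y ∧ w y < (4 * K) ^ (i + 2)}) := by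
  set A := 4 * K with hA
  set B := Metric.ball x r with hB
  set S := B ∩ {y | A ^ i ≤ w y ∧ w y < A ^ (i + 2)} with hS
  have hAt : A ≠ ∞ := ENNReal.mul_ne_top (by simp) hK
  have hK0 : K ≠ 0 := (zero_lt_one.trans_le hK1).ne'
  have hA0 : A ≠ 0 := mul_ne_zero (by simp) hK0
  have hBt : volume B ≠ ∞ := measure_ball_lt_top.ne
  have hSt : volume S ≠ ∞ := ne_top_of_le_ne_top hBt (measure_mono inter_subset_left)
  have h1 : ∫⁻ y in B, w y ≤ A ^ i * volume B + A ^ (i + 2) * volume S := by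
    calc ∫⁻ y in B, w y ≤ ∫⁻ y in B, (A ^ i + S.indicator (fun _ => A ^ (i + 2)) y) := by
          refine setLIntegral_mono' measurableSet_ball fun y hy => ?_
          by_cases hy' : A ^ i ≤ w y
          · have : y ∈ S := ⟨hy, hy', hw y hy⟩
            rw [indicator_of_mem this]
            exact (hw y hy).le.trans le_add_self
          · exact (not_le.1 hy').le.trans le_self_add
      _ = A ^ i * volume B + ∫⁻ y in B, S.indicator (fun _ => A ^ (i + 2)) y := by
          rw [lintegral_add_left measurable_const, setLIntegral_const]
      _ ≤ A ^ i * volume B + A ^ (i + 2) * volume S := by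
          gcongr
          exact (lintegral_indicator_const_le _ _).trans
            (mul_le_mul_right (Measure.restrict_apply_le _ _) _)
  have h2 : A ^ (i + 1) * volume B ≤ K * (A ^ i * volume B + A ^ (i + 2) * volume S) :=
    (mul_le_mul_left hwx _).trans ((h x r hr hx).trans (mul_le_mul_right h1 _))
  -- The choice `A = 4K` pays off here: cancelling `K A^i` leaves `4|B| ≤ |B| + A²|S|`.
  have h3 : (K * A ^ i) * (4 * volume B) ≤ (K * A ^ i) * (volume B + A ^ 2 * volume S) := by
    calc _ = A ^ (i + 1) * volume B := by rw [pow_succ, hA]; ring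
      _ ≤ _ := h2
      _ = _ := by ring
  have h4 := (ENNReal.mul_le_mul_iff_right (mul_ne_zero hK0 (pow_ne_zero i hA0))
    (ENNReal.mul_ne_top hK (ENNReal.pow_ne_top hAt))).1 h3
  have h5 : volume B + volume B ≤ volume B + A ^ 2 * volume S := by
    refine le_trans ?_ h4
    rw [← two_mul]; gcongr; norm_num
  exact (ENNReal.add_le_add_iff_left hBt).1 h5

/-- Domar's chain argument: if all level sets inside a ball are small compared with balls of radii
`r i`, then a large value at the centre propagates along a chain, which must leave the ball. -/
theorem SubMeanValue.le_sum_radii {N : ℕ} {K : ℝ≥0∞} {w : EuclideanSpace ℝ (Fin N) → ℝ≥0∞}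
    {x₀ : EuclideanSpace ℝ (Fin N)} {R : ℝ} (h : SubMeanValue K w (Metric.ball x₀ R))
    (hK1 : 1 ≤ K) (hK : K ≠ ∞) {J : ℕ} (hJ : ∀ x ∈ Metric.ball x₀ R, w x < (4 * K) ^ (J + 1))
    {r : ℕ → ℝ} (hr : ∀ i, 0 < r i)
    (hvol : ∀ i, (4 * K) ^ 2 * volume (Metric.ball x₀ R ∩
      {y | (4 * K) ^ i ≤ w y ∧ w y < (4 * K) ^ (i + 2)}) <
        volume (Metric.ball (0 : EuclideanSpace ℝ (Fin N)) (r i)))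
    {j : ℕ} (hj : (4 * K) ^ (j + 1) ≤ w x₀) : R ≤ ∑ i ∈ Finset.Ico j J, r i := by
  -- Induction on `d`, a bound for the number of levels left below `J`. When none is left, `w x ≥
  -- A^(J+1)` is impossible inside the ball.
  have key : ∀ d j : ℕ, J ≤ j + d → ∀ x, (4 * K) ^ (j + 1) ≤ w x →
      R ≤ dist x x₀ + ∑ i ∈ Finset.Ico j J, r i := by
    intro d
    induction d with
    | zero =>
      intro j hjJ x hx
      by_contra hlt
      push Not at hlt
      have h0 : 0 ≤ ∑ i ∈ Finset.Ico j J, r i := Finset.sum_nonneg fun i _ => (hr i).le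
      have := hJ x (by rw [Metric.mem_ball]; linarith)
      refine absurd (hx.trans_lt this) (not_lt.2 ?_)
      refine pow_le_pow_right₀ (hK1.trans ?_) (by omega)
      exact le_mul_of_one_le_left' (by norm_num)
    | succ d ih =>
      intro j hjJ x hx
      rcases le_or_gt J j with hle | hlt'
      · exact ih j (by omega) x hx
      by_contra hlt
      push Not at hlt
      rw [Finset.sum_eq_sum_Ico_succ_bot hlt'] at hlt
      have h0 : 0 ≤ ∑ i ∈ Finset.Ico (j + 1) J, r i := Finset.sum_nonneg fun i _ => (hr i).le
      have hsub : Metric.closedBall x (r j) ⊆ Metric.ball x₀ R :=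
        Metric.closedBall_subset_ball' (by linarith)
      -- Either the chain moves to `y`, at cost less than `r j`, or the band fills a proportion of
      -- the ball that `hvol` excludes.
      by_cases hex : ∃ y ∈ Metric.ball x (r j), (4 * K) ^ (j + 2) ≤ w y
      · obtain ⟨y, hy, hwy⟩ := hex
        have h1 := ih (j + 1) (by omega) y hwy
        have h2 := dist_triangle y x x₀
        rw [Metric.mem_ball] at hy
        linarith
      · push Not at hex
        have h1 := h.volume_ball_le hK1 hK (hr j) hsub hx hex
        have h2 := hvol j
        rw [volume_ball_eq_ofReal_pow_mul _ (hr j)] at h1 h2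
        refine absurd (h1.trans ?_) (not_le.2 h2)
        gcongr
        exact Metric.ball_subset_closedBall.trans hsub
  simpa using key J j (by omega) x₀ hj

theorem SubMeanValue.ofReal_le_sum {N : ℕ} (hN : 0 < N) {K : ℝ≥0∞}
    {w : EuclideanSpace ℝ (Fin N) → ℝ≥0∞}
    {x₀ : EuclideanSpace ℝ (Fin N)} {R : ℝ} (h : SubMeanValue K w (Metric.ball x₀ R))
    (hK1 : 1 ≤ K) (hK : K ≠ ∞) {J : ℕ} (hJ : ∀ x ∈ Metric.ball x₀ R, w x < (4 * K) ^ (J + 1))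
    {j : ℕ} (hj : (4 * K) ^ (j + 1) ≤ w x₀) :
    ENNReal.ofReal R ≤ ∑ i ∈ Finset.Ico j J,
      ((4 * K) ^ 2 / volume (Metric.ball (0 : EuclideanSpace ℝ (Fin N)) 1) *
        volume (Metric.ball x₀ R ∩ {y | (4 * K) ^ i ≤ w y ∧ w y < (4 * K) ^ (i + 2)})) ^
          (N : ℝ)⁻¹ := by
  set A := 4 * K with hA
  set ν := volume (Metric.ball (0 : EuclideanSpace ℝ (Fin N)) 1) with hν
  set S : ℕ → Set (EuclideanSpace ℝ (Fin N)) := fun i =>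
    Metric.ball x₀ R ∩ {y | A ^ i ≤ w y ∧ w y < A ^ (i + 2)} with hS
  have hAt : A ≠ ∞ := ENNReal.mul_ne_top (by simp) hK
  have hν0 : ν ≠ 0 := (Metric.measure_ball_pos _ _ one_pos).ne'
  have hνt : ν ≠ ∞ := measure_ball_lt_top.ne
  have hN' : (N : ℝ) ≠ 0 := by positivity
  set q : ℕ → ℝ≥0∞ := fun i => (A ^ 2 / ν * volume (S i)) ^ (N : ℝ)⁻¹ with hq
  have hqt : ∀ i, q i ≠ ∞ := fun i =>
    ENNReal.rpow_ne_top_of_nonneg (by positivity) (ENNReal.mul_ne_top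
      (ENNReal.div_ne_top (ENNReal.pow_ne_top hAt) hν0)
      (ne_top_of_le_ne_top measure_ball_lt_top.ne (measure_mono inter_subset_left)))
  -- `q i` is the critical radius, with `A²|S i| = (q i)^N ν`. The chain argument needs positive
  -- radii and strict inequality, hence the extra `ε`, sent to `0` afterwards.
  have hε : ∀ ε : ℝ, 0 < ε → R ≤ ∑ i ∈ Finset.Ico j J, (q i).toReal + ∑ i ∈ Finset.Ico j J, ε := by
    intro ε hε
    rw [← Finset.sum_add_distrib]
    refine h.le_sum_radii hK1 hK hJ (r := fun i => (q i).toReal + ε) (fun i => by positivity)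
      (fun i => ?_) hj
    rw [volume_ball_eq_ofReal_pow_mul _ (by positivity), ← hν]
    have h1 : A ^ 2 * volume (S i) = q i ^ N * ν := by
      rw [ENNReal.rpow_inv_natCast_pow hN.ne', mul_right_comm, ENNReal.div_mul_cancel hν0 hνt]
    have h2 : q i < ENNReal.ofReal ((q i).toReal + ε) := by
      rw [ENNReal.lt_ofReal_iff_toReal_lt (hqt i)]; linarith
    refine h1.trans_lt ?_
    gcongr
  have hfin : R ≤ ∑ i ∈ Finset.Ico j J, (q i).toReal := by
    have hlim : Filter.Tendsto (fun ε : ℝ => ∑ i ∈ Finset.Ico j J, (q i).toReal +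
        ∑ i ∈ Finset.Ico j J, ε) (nhdsWithin 0 (Ioi 0))
        (nhds (∑ i ∈ Finset.Ico j J, (q i).toReal + ∑ i ∈ Finset.Ico j J, 0)) :=
      (Continuous.tendsto (by fun_prop) 0).mono_left nhdsWithin_le_nhds
    simpa using ge_of_tendsto hlim (by filter_upwards [self_mem_nhdsWithin] with ε h using hε ε h)
  rw [← ENNReal.toReal_sum fun i _ => hqt i] at hfin
  exact ENNReal.ofReal_le_of_le_toReal hfin

/-- Domar's estimate: quantitative control of the supremum of a function with the mean value
property by an integral of a majorant of its level sets. -/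
theorem SubMeanValue.volume_ball_le_of_levels {N : ℕ} (hN : 2 ≤ N) {K : ℝ≥0∞}
    {w G : EuclideanSpace ℝ (Fin N) → ℝ≥0∞}
    {x₀ : EuclideanSpace ℝ (Fin N)} {R : ℝ} (hR : 0 < R)
    (h : SubMeanValue K w (Metric.ball x₀ R)) (hK1 : 1 ≤ K) (hK : K ≠ ∞)
    (hw : AEMeasurable w (volume.restrict (Metric.ball x₀ R)))
    (hbdd : ∃ C : ℝ≥0∞, C ≠ ∞ ∧ ∀ x ∈ Metric.ball x₀ R, w x ≤ C)
    {a : ℕ → ℝ≥0∞} (hat : ∀ i, a i ≠ ∞) {j : ℕ}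
    (haG : ∀ i, j ≤ i → ∀ x ∈ Metric.ball x₀ R, (4 * K) ^ i ≤ w x → 1 ≤ a i ^ (N - 1) * G x)
    (hj : (4 * K) ^ (j + 1) ≤ w x₀) :
    volume (Metric.ball x₀ R) ≤
      2 * (4 * K) ^ 2 * (∑' i, a (j + i)) ^ (N - 1) * ∫⁻ x in Metric.ball x₀ R, G x := by
  obtain ⟨C, hC, hwC⟩ := hbdd
  set A := 4 * K with hA
  have hA1 : 1 < A := by
    refine lt_of_lt_of_le (by norm_num : (1 : ℝ≥0∞) < 4) (le_mul_of_one_le_right' hK1)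
  obtain ⟨J, hJ⟩ : ∃ J : ℕ, C < A ^ (J + 1) := by
    have := (ENNReal.tendsto_pow_atTop_nhds_top_iff.2 hA1).comp (Filter.tendsto_add_atTop_nat 1)
    exact (this.eventually (lt_mem_nhds hC.lt_top)).exists
  set B := Metric.ball x₀ R with hB
  set ν := volume (Metric.ball (0 : EuclideanSpace ℝ (Fin N)) 1) with hν
  have hν0 : ν ≠ 0 := (Metric.measure_ball_pos _ _ one_pos).ne'
  have hνt : ν ≠ ∞ := measure_ball_lt_top.ne
  have h1 := h.ofReal_le_sum (by omega) hK1 hK (fun x hx => (hwC x hx).trans_lt hJ) hj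
  rw [← hA, ← hν, ← hB] at h1
  set L : ℕ → Set (EuclideanSpace ℝ (Fin N)) := fun i => w ⁻¹' Ico (A ^ i) (A ^ (i + 1)) with hL
  have hLm : ∀ i, NullMeasurableSet (L i) (volume.restrict B) := fun i =>
    hw.nullMeasurable measurableSet_Ico
  have hLd : Pairwise (Function.onFun Disjoint L) := by
    have hmono : Monotone fun i : ℕ => A ^ i := pow_right_mono₀ hA1.le
    intro i k hik
    exact (hmono.pairwise_disjoint_on_Ico_succ hik).preimage w
  set I : ℕ → ℝ≥0∞ := fun i => ∫⁻ x in L i, G x ∂(volume.restrict B) with hI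
  have hIsum : ∑' i, I i ≤ ∫⁻ x in B, G x := by
    rw [hI, ← lintegral_iUnion₀ hLm (fun i k hik => (hLd hik).aedisjoint)]
    exact setLIntegral_le_lintegral _ _
  set g : ℕ → ℝ≥0∞ := fun i => I i + I (i + 1) with hg
  -- Each band consists of two consecutive layers `L i`, `L (i + 1)`, so the bands cover each point
  -- at most twice: this is the factor `2`.
  have hgsum : ∀ s : Finset ℕ, ∑ i ∈ s, g i ≤ 2 * ∫⁻ x in B, G x := by
    intro s
    rw [Finset.sum_add_distrib, two_mul]
    have h2 : ∑' i, I (i + 1) ≤ ∑' i, I i :=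
      ENNReal.tsum_comp_le_tsum_of_injective (add_left_injective 1) _
    exact add_le_add ((ENNReal.sum_le_tsum s).trans hIsum)
      ((ENNReal.sum_le_tsum s).trans (h2.trans hIsum))
  have hvol : ∀ i, j ≤ i → volume (B ∩ {y | A ^ i ≤ w y ∧ w y < A ^ (i + 2)}) ≤
      a i ^ (N - 1) * g i := by
    intro i hi
    have hsub : B ∩ {y | A ^ i ≤ w y ∧ w y < A ^ (i + 2)} ⊆ (L i ∪ L (i + 1)) ∩ B := by
      rintro y ⟨hyB, hy1, hy2⟩
      refine ⟨?_, hyB⟩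
      rcases lt_or_ge (w y) (A ^ (i + 1)) with h | h
      · exact .inl ⟨hy1, h⟩
      · exact .inr ⟨h, hy2⟩
    have hone : ∀ k, i ≤ k → volume.restrict B (L k) ≤ a i ^ (N - 1) * I k := by
      intro k hk
      rw [hI, ← lintegral_const_mul' _ _ (ENNReal.pow_ne_top (hat i)), ← setLIntegral_one]
      have hB' : ∀ᵐ y ∂(volume.restrict B), y ∈ B := ae_restrict_mem measurableSet_ball
      refine lintegral_mono_ae ?_
      filter_upwards [ae_restrict_mem₀ (hLm k), ae_restrict_of_ae hB'] with y hy hyB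
      exact haG i hi y hyB ((pow_le_pow_right₀ hA1.le hk).trans hy.1)
    calc _ ≤ volume ((L i ∪ L (i + 1)) ∩ B) := measure_mono hsub
      _ = volume.restrict B (L i ∪ L (i + 1)) := (Measure.restrict_apply' measurableSet_ball).symm
      _ ≤ volume.restrict B (L i) + volume.restrict B (L (i + 1)) := measure_union_le _ _
      _ ≤ a i ^ (N - 1) * I i + a i ^ (N - 1) * I (i + 1) :=
        add_le_add (hone i le_rfl) (hone _ (Nat.le_succ i))
      _ = _ := (mul_add _ _ _).symm
  have hN0 : (0 : ℝ) < N := by positivity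
  have hN1 : (0 : ℝ) < ((N - 1 : ℕ) : ℝ) := by
    have : 0 < N - 1 := by omega
    exact_mod_cast this
  have hNc : ((N - 1 : ℕ) : ℝ) = N - 1 := by
    push_cast [Nat.cast_sub (by omega : 1 ≤ N)]; ring
  have hpq : ((N : ℝ) / ((N - 1 : ℕ) : ℝ)).HolderConjugate N := by
    rw [Real.holderConjugate_iff]
    constructor
    · rw [lt_div_iff₀ hN1, hNc]; linarith
    · rw [hNc] at hN1 ⊢; field_simp; ring
  -- Hölder's inequality with exponents `N/(N-1)` and `N`, applied to `a_i^((N-1)/N) · g_i^(1/N)`.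
  have h2 : ENNReal.ofReal R ≤ (A ^ 2 / ν) ^ (N : ℝ)⁻¹ *
      ((∑' i, a (j + i)) ^ (((N - 1 : ℕ) : ℝ) / N) *
        (2 * ∫⁻ x in B, G x) ^ (N : ℝ)⁻¹) := by
    refine h1.trans ?_
    have h3 : ∀ i ∈ Finset.Ico j J,
        (A ^ 2 / ν * volume (B ∩ {y | A ^ i ≤ w y ∧ w y < A ^ (i + 2)})) ^ (N : ℝ)⁻¹ ≤
          (A ^ 2 / ν) ^ (N : ℝ)⁻¹ *
            (a i ^ (((N - 1 : ℕ) : ℝ) / N) * g i ^ (N : ℝ)⁻¹) := by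
      intro i hi
      rw [ENNReal.mul_rpow_of_nonneg _ _ (by positivity)]
      gcongr
      calc _ ≤ (a i ^ (N - 1) * g i) ^ (N : ℝ)⁻¹ := by
            gcongr; exact hvol i (Finset.mem_Ico.1 hi).1
        _ = _ := by
          rw [ENNReal.mul_rpow_of_nonneg _ _ (by positivity), ← ENNReal.rpow_natCast,
            ← ENNReal.rpow_mul, div_eq_mul_inv]
    refine (Finset.sum_le_sum h3).trans ?_
    rw [← Finset.mul_sum]
    gcongr
    refine (ENNReal.inner_le_Lp_mul_Lq _ _ _ hpq).trans ?_
    have e1 : ∀ i, (a i ^ (((N - 1 : ℕ) : ℝ) / N)) ^ ((N : ℝ) / ((N - 1 : ℕ) : ℝ)) = a i := by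
      intro i
      rw [← ENNReal.rpow_mul]
      rw [show ((N - 1 : ℕ) : ℝ) / N * (N / ((N - 1 : ℕ) : ℝ)) = 1 by field_simp, ENNReal.rpow_one]
    have e2 : ∀ i, (g i ^ (N : ℝ)⁻¹) ^ (N : ℝ) = g i := by
      intro i
      rw [← ENNReal.rpow_mul, inv_mul_cancel₀ hN0.ne', ENNReal.rpow_one]
    simp only [e1, e2, one_div, inv_div]
    gcongr
    · rw [Finset.sum_Ico_eq_sum_range]
      exact ENNReal.sum_le_tsum _
    · exact hgsum _
  calc volume B = ENNReal.ofReal R ^ N * ν := volume_ball_eq_ofReal_pow_mul _ hR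
    _ ≤ ((A ^ 2 / ν) ^ (N : ℝ)⁻¹ * ((∑' i, a (j + i)) ^ (((N - 1 : ℕ) : ℝ) / N) *
        (2 * ∫⁻ x in B, G x) ^ (N : ℝ)⁻¹)) ^ N * ν := by gcongr
    _ = (A ^ 2 / ν * ((∑' i, a (j + i)) ^ (N - 1) * (2 * ∫⁻ x in B, G x))) * ν := by
      congr 1
      rw [mul_pow, mul_pow (_ ^ (_ / _)), ENNReal.rpow_inv_natCast_pow (by omega),
        ENNReal.rpow_inv_natCast_pow (by omega), ← ENNReal.rpow_natCast (_ ^ (_ / _)),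
        ← ENNReal.rpow_mul, div_mul_cancel₀ _ hN0.ne', ENNReal.rpow_natCast]
    _ = (A ^ 2 / ν * ν) * ((∑' i, a (j + i)) ^ (N - 1) * (2 * ∫⁻ x in B, G x)) := by ring
    _ = _ := by rw [ENNReal.div_mul_cancel hν0 hνt]; ring

/-! ### The splitting `ℝ^(m+n) = ℝ^m × ℝ^n` and Tonelli's theorem -/

theorem measurePreserving_finAppend (m n : ℕ) :
    MeasurePreserving (fun p : (Fin m → ℝ) × (Fin n → ℝ) => Fin.append p.1 p.2) := by
  have h1 := volume_measurePreserving_sumPiEquivProdPi_symm (fun _ : Fin m ⊕ Fin n => ℝ)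
  have h2 := volume_measurePreserving_piCongrLeft (fun _ : Fin (m + n) => ℝ) finSumFinEquiv
  have h3 := h2.comp h1
  have e : (fun p : (Fin m → ℝ) × (Fin n → ℝ) => Fin.append p.1 p.2) =
      MeasurableEquiv.piCongrLeft (fun _ : Fin (m + n) => ℝ) finSumFinEquiv ∘
        (MeasurableEquiv.sumPiEquivProdPi fun _ : Fin m ⊕ Fin n => ℝ).symm := by
    funext p
    ext i
    refine Fin.addCases (fun i => ?_) (fun i => ?_) i
    · rw [Fin.append_left]
      exact (MeasurableEquiv.piCongrLeft_apply_apply (β := fun _ : Fin (m + n) => ℝ)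
        finSumFinEquiv
        ((MeasurableEquiv.sumPiEquivProdPi fun _ : Fin m ⊕ Fin n => ℝ).symm p) (Sum.inl i)).symm
    · rw [Fin.append_right]
      exact (MeasurableEquiv.piCongrLeft_apply_apply (β := fun _ : Fin (m + n) => ℝ)
        finSumFinEquiv
        ((MeasurableEquiv.sumPiEquivProdPi fun _ : Fin m ⊕ Fin n => ℝ).symm p) (Sum.inr i)).symm
  rw [e]
  exact h3

theorem measurePreserving_joinPt (m n : ℕ) :
    MeasurePreserving
      (fun p : EuclideanSpace ℝ (Fin m) × EuclideanSpace ℝ (Fin n) => joinPt p.1 p.2) := by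
  have h1 := (PiLp.volume_preserving_ofLp (Fin m)).prod (PiLp.volume_preserving_ofLp (Fin n))
  exact (PiLp.volume_preserving_toLp (Fin (m + n))).comp ((measurePreserving_finAppend m n).comp h1)

theorem joinPt_sub {m n : ℕ} (x x' : EuclideanSpace ℝ (Fin m)) (y y' : EuclideanSpace ℝ (Fin n)) :
    joinPt x y - joinPt x' y' = joinPt (x - x') (y - y') := by
  ext i
  refine Fin.addCases (fun i => ?_) (fun i => ?_) i <;> simp [joinPt]

theorem norm_joinPt_sq {m n : ℕ} (x : EuclideanSpace ℝ (Fin m)) (y : EuclideanSpace ℝ (Fin n)) :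
    ‖joinPt x y‖ ^ 2 = ‖x‖ ^ 2 + ‖y‖ ^ 2 := by
  simp [EuclideanSpace.norm_sq_eq, joinPt, Fin.sum_univ_add]

theorem norm_joinPt_le {m n : ℕ} (x : EuclideanSpace ℝ (Fin m)) (y : EuclideanSpace ℝ (Fin n)) :
    ‖joinPt x y‖ ≤ ‖x‖ + ‖y‖ := by
  refine abs_le_of_sq_le_sq' ?_ (by positivity) |>.2
  rw [norm_joinPt_sq]
  nlinarith [mul_nonneg (norm_nonneg x) (norm_nonneg y)]

theorem dist_joinPt_le {m n : ℕ} (x x' : EuclideanSpace ℝ (Fin m))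
    (y y' : EuclideanSpace ℝ (Fin n)) :
    dist (joinPt x y) (joinPt x' y') ≤ dist x x' + dist y y' := by
  simpa only [dist_eq_norm, joinPt_sub] using norm_joinPt_le (x - x') (y - y')

theorem dist_le_dist_joinPt {m n : ℕ} (x x' : EuclideanSpace ℝ (Fin m))
    (y y' : EuclideanSpace ℝ (Fin n)) :
    dist x x' ≤ dist (joinPt x y) (joinPt x' y') ∧ dist y y' ≤ dist (joinPt x y) (joinPt x' y') := by
  simp only [dist_eq_norm, joinPt_sub]
  have := norm_joinPt_sq (x - x') (y - y')
  constructor <;> refine abs_le_of_sq_le_sq' ?_ (by positivity) |>.2 <;> rw [this] <;>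
    nlinarith [sq_nonneg ‖x - x'‖, sq_nonneg ‖y - y'‖]

theorem exists_eq_joinPt {m n : ℕ} (z : EuclideanSpace ℝ (Fin (m + n))) :
    ∃ (x : EuclideanSpace ℝ (Fin m)) (y : EuclideanSpace ℝ (Fin n)), z = joinPt x y := by
  refine ⟨WithLp.toLp 2 fun i => z (Fin.castAdd n i), WithLp.toLp 2 fun i => z (Fin.natAdd m i), ?_⟩
  ext i
  refine Fin.addCases (fun i => ?_) (fun i => ?_) i <;> simp [joinPt]

theorem injective_joinPt {m n : ℕ} : Function.Injective
    (fun p : EuclideanSpace ℝ (Fin m) × EuclideanSpace ℝ (Fin n) => joinPt p.1 p.2) := by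
  rintro ⟨x, y⟩ ⟨x', y'⟩ h
  have h0 := dist_le_dist_joinPt x x' y y'
  simp only at h
  rw [h, dist_self] at h0
  exact Prod.ext (dist_le_zero.1 h0.1) (dist_le_zero.1 h0.2)

theorem continuous_joinPt {m n : ℕ} : Continuous
    (fun p : EuclideanSpace ℝ (Fin m) × EuclideanSpace ℝ (Fin n) => joinPt p.1 p.2) := by
  unfold joinPt
  refine (PiLp.continuous_toLp 2 _).comp (continuous_pi fun i => ?_)
  refine Fin.addCases (fun i => ?_) (fun i => ?_) i
  · simp only [Fin.append_left]; fun_prop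
  · simp only [Fin.append_right]; fun_prop

/-- By the Lusin–Souslin theorem, a continuous injection suffices. -/
theorem measurableEmbedding_joinPt {m n : ℕ} : MeasurableEmbedding
    (fun p : EuclideanSpace ℝ (Fin m) × EuclideanSpace ℝ (Fin n) => joinPt p.1 p.2) :=
  continuous_joinPt.measurableEmbedding injective_joinPt

/-- Transfer of an a.e.-measurable function on `D` to a product set mapped into `D`. -/
theorem aemeasurable_comp_joinPt {m n : ℕ} {f : EuclideanSpace ℝ (Fin (m + n)) → ℝ≥0∞}
    {D : Set (EuclideanSpace ℝ (Fin (m + n)))} (hf : AEMeasurable f (volume.restrict D))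
    {s : Set (EuclideanSpace ℝ (Fin m))} {t : Set (EuclideanSpace ℝ (Fin n))}
    (hst : ∀ x ∈ s, ∀ y ∈ t, joinPt x y ∈ D) :
    AEMeasurable (fun p : EuclideanSpace ℝ (Fin m) × EuclideanSpace ℝ (Fin n) =>
      f (joinPt p.1 p.2)) ((volume.restrict s).prod (volume.restrict t)) := by
  rw [Measure.prod_restrict]
  have h1 := ((measurePreserving_joinPt m n).restrict_preimage_emb
    measurableEmbedding_joinPt D)
  have h2 := hf.comp_quasiMeasurePreserving h1.quasiMeasurePreserving
  exact h2.mono_measure (Measure.restrict_mono (fun p hp => hst _ hp.1 _ hp.2) le_rfl)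

/-- Tonelli's theorem over a product set mapped into `D`. -/
theorem lintegral_lintegral_joinPt_le {m n : ℕ} {f : EuclideanSpace ℝ (Fin (m + n)) → ℝ≥0∞}
    {D : Set (EuclideanSpace ℝ (Fin (m + n)))} (hf : AEMeasurable f (volume.restrict D))
    {s : Set (EuclideanSpace ℝ (Fin m))} {t : Set (EuclideanSpace ℝ (Fin n))}
    (hst : ∀ x ∈ s, ∀ y ∈ t, joinPt x y ∈ D) :
    ∫⁻ x in s, ∫⁻ y in t, f (joinPt x y) ≤ ∫⁻ z in D, f z := by
  rw [← lintegral_prod _ (aemeasurable_comp_joinPt hf hst), Measure.prod_restrict]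
  rw [← (measurePreserving_joinPt m n).setLIntegral_comp_preimage_emb measurableEmbedding_joinPt]
  exact lintegral_mono_set fun p hp => hst _ hp.1 _ hp.2

/-! ### Domar's estimate in each variable: the local bound -/

/-- A function with the mean value property separately in each variable is locally bounded, under
an integrability condition on a majorant `Ψ` of its level sets. -/
theorem exists_bound_of_separate_subMeanValue {m n : ℕ} (hm : 2 ≤ m) (hn : 2 ≤ n) {K : ℝ≥0∞}
    (hK1 : 1 ≤ K) (hK : K ≠ ∞) {v Ψ : EuclideanSpace ℝ (Fin (m + n)) → ℝ≥0∞}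
    {xc : EuclideanSpace ℝ (Fin m)} {yc : EuclideanSpace ℝ (Fin n)} {ρ : ℝ} (hρ : 0 < ρ)
    (hx : ∀ y ∈ Metric.ball yc (2 * ρ),
      SubMeanValue K (fun x => v (joinPt x y)) (Metric.ball xc (2 * ρ)))
    (hxm : ∀ y ∈ Metric.ball yc (2 * ρ),
      AEMeasurable (fun x => v (joinPt x y)) (volume.restrict (Metric.ball xc (2 * ρ))))
    (hxb : ∀ y ∈ Metric.ball yc (2 * ρ), ∃ C : ℝ≥0∞, C ≠ ∞ ∧
      ∀ x ∈ Metric.ball xc (2 * ρ), v (joinPt x y) ≤ C)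
    (hy : ∀ x ∈ Metric.ball xc (2 * ρ),
      SubMeanValue K (fun y => v (joinPt x y)) (Metric.ball yc (2 * ρ)))
    (hym : ∀ x ∈ Metric.ball xc (2 * ρ),
      AEMeasurable (fun y => v (joinPt x y)) (volume.restrict (Metric.ball yc (2 * ρ))))
    (hyb : ∀ x ∈ Metric.ball xc (2 * ρ), ∃ C : ℝ≥0∞, C ≠ ∞ ∧
      ∀ y ∈ Metric.ball yc (2 * ρ), v (joinPt x y) ≤ C)
    (hΨ : ∫⁻ x in Metric.ball xc (2 * ρ), ∫⁻ y in Metric.ball yc (2 * ρ), Ψ (joinPt x y) ≠ ∞)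
    {a : ℕ → ℝ≥0∞} (hat : ∀ i, a i ≠ ∞)
    (haΨ : ∀ i, ∀ x ∈ Metric.ball xc (2 * ρ), ∀ y ∈ Metric.ball yc (2 * ρ),
      (4 * K) ^ (i + 2) ≤ v (joinPt x y) → 1 ≤ a i ^ (n - 1) * Ψ (joinPt x y))
    (hT : ∑' j, (∑' i, a (j + i)) ^ (((n : ℝ) - 1) / ((m : ℝ) - 1)) ≠ ∞) :
    ∃ C : ℝ≥0∞, C ≠ ∞ ∧ ∀ x ∈ Metric.ball xc ρ, ∀ y ∈ Metric.ball yc ρ, v (joinPt x y) ≤ C := by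
  set A := 4 * K with hA
  have hAt : A ≠ ∞ := ENNReal.mul_ne_top (by simp) hK
  have hnR : (0 : ℝ) < (n : ℝ) - 1 := by
    have : (2 : ℝ) ≤ n := by exact_mod_cast hn
    linarith
  have hmR : (0 : ℝ) < (m : ℝ) - 1 := by
    have : (2 : ℝ) ≤ m := by exact_mod_cast hm
    linarith
  set θ := ((n : ℝ) - 1) / ((m : ℝ) - 1) with hθ
  have hθ0 : 0 < θ := div_pos hnR hmR
  set T : ℕ → ℝ≥0∞ := fun j => ∑' i, a (j + i) with hTdef
  have hTθ : ∀ j, T j ^ θ ≠ ∞ := ENNReal.ne_top_of_tsum_ne_top hT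
  set f : EuclideanSpace ℝ (Fin m) → ℝ≥0∞ := fun x =>
    ∫⁻ y in Metric.ball yc (2 * ρ), Ψ (joinPt x y) with hf
  have hsubx : ∀ x ∈ Metric.ball xc ρ, Metric.ball x ρ ⊆ Metric.ball xc (2 * ρ) := fun x hx =>
    Metric.ball_subset_ball' (by rw [Metric.mem_ball] at hx; linarith)
  have hsuby : ∀ y ∈ Metric.ball yc ρ, Metric.ball y ρ ⊆ Metric.ball yc (2 * ρ) := fun y hy =>
    Metric.ball_subset_ball' (by rw [Metric.mem_ball] at hy; linarith)
  set Vm := volume (Metric.ball (0 : EuclideanSpace ℝ (Fin m)) ρ) with hVm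
  set Vn := volume (Metric.ball (0 : EuclideanSpace ℝ (Fin n)) ρ) with hVn
  have hVm0 : Vm ≠ 0 := (Metric.measure_ball_pos _ _ hρ).ne'
  have hVn0 : Vn ≠ 0 := (Metric.measure_ball_pos _ _ hρ).ne'
  have hVnt : Vn ≠ ∞ := measure_ball_lt_top.ne
  -- Domar's estimate in `y`. The weights are shifted by `2` because `haΨ` speaks of levels `i + 2`;
  -- the values of `a (i - 2)` for `i < 2` play no role.
  have inner : ∀ J, ∀ x ∈ Metric.ball xc (2 * ρ), ∀ y ∈ Metric.ball yc ρ,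
      A ^ (J + 3) ≤ v (joinPt x y) → Vn ≤ 2 * A ^ 2 * T J ^ (n - 1) * f x := by
    intro J x hxx y hyy hv
    have h1 := ((hy x hxx).mono (hsuby y hyy)).volume_ball_le_of_levels hn hρ hK1 hK
      ((hym x hxx).mono_measure (Measure.restrict_mono (hsuby y hyy) le_rfl))
      (by obtain ⟨C, hC, h⟩ := hyb x hxx; exact ⟨C, hC, fun z hz => h z (hsuby y hyy hz)⟩)
      (a := fun i => a (i - 2)) (fun i => hat _) (G := fun z => Ψ (joinPt x z)) (j := J + 2)
      (by
        intro i hi z hz hv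
        obtain ⟨k, rfl⟩ := Nat.exists_eq_add_of_le' (show 2 ≤ i by omega)
        exact haΨ k x hxx z (hsuby y hyy hz) hv) hv
    rw [volume_ball_eq_ofReal_pow_mul _ hρ, ← volume_ball_eq_ofReal_pow_mul 0 hρ] at h1
    refine h1.trans ?_
    have e : ∀ i, J + 2 + i - 2 = J + i := fun i => by omega
    simp only [e]
    gcongr
    exact lintegral_mono_set (hsuby y hyy)
  set c : ℝ≥0∞ := 2 * A ^ 2 / Vn with hc
  have hct : c ≠ ∞ :=
    ENNReal.div_ne_top (ENNReal.mul_ne_top (by simp) (ENNReal.pow_ne_top hAt)) hVn0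
  -- Domar's estimate in `x`. By `inner`, `c * f` majorizes the level sets with weights `T k ^ θ`,
  -- since `(T^θ)^(m-1) = T^(n-1)`; the starting level loses one more step.
  have outer : ∀ J, ∀ x ∈ Metric.ball xc ρ, ∀ y ∈ Metric.ball yc ρ,
      A ^ (J + 4) ≤ v (joinPt x y) →
        Vm ≤ 2 * A ^ 2 * (∑' i, T (J + i) ^ θ) ^ (m - 1) *
          (c * ∫⁻ x in Metric.ball xc (2 * ρ), f x) := by
    intro J x hxx y hyy hv
    have hy2 : y ∈ Metric.ball yc (2 * ρ) := Metric.ball_subset_ball (by linarith) hyy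
    have h1 := ((hx y hy2).mono (hsubx x hxx)).volume_ball_le_of_levels hm hρ hK1 hK
      ((hxm y hy2).mono_measure (Measure.restrict_mono (hsubx x hxx) le_rfl))
      (by obtain ⟨C, hC, h⟩ := hxb y hy2; exact ⟨C, hC, fun z hz => h z (hsubx x hxx hz)⟩)
      (a := fun i => T (i - 3) ^ θ) (fun i => hTθ _) (G := fun z => c * f z) (j := J + 3)
      (by
        intro i hi z hz hv
        obtain ⟨k, rfl⟩ := Nat.exists_eq_add_of_le' (show 3 ≤ i by omega)
        have h2 := inner k z (hsubx x hxx hz) y hyy hv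
        have e : (T k ^ θ) ^ (m - 1) = T k ^ (n - 1) := by
          rw [← ENNReal.rpow_natCast, ← ENNReal.rpow_mul, ← ENNReal.rpow_natCast]
          congr 1
          rw [Nat.cast_sub (by omega), Nat.cast_sub (by omega), hθ]
          push_cast
          field_simp
        simp only [Nat.add_sub_cancel, e]
        calc (1 : ℝ≥0∞) = Vn / Vn := (ENNReal.div_self hVn0 hVnt).symm
          _ ≤ (2 * A ^ 2 * T k ^ (n - 1) * f z) / Vn := by gcongr
          _ = _ := by rw [hc, div_eq_mul_inv, div_eq_mul_inv]; ring) hv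
    rw [volume_ball_eq_ofReal_pow_mul _ hρ, ← volume_ball_eq_ofReal_pow_mul 0 hρ] at h1
    refine h1.trans ?_
    have e : ∀ i, J + 3 + i - 3 = J + i := fun i => by omega
    simp only [e]
    rw [lintegral_const_mul' _ _ hct]
    gcongr
    exact hsubx x hxx
  -- Tails of the convergent series `∑ T^θ` tend to `0`, so `outer` fails for large `J`.
  have hlim : Filter.Tendsto (fun J => 2 * A ^ 2 * (∑' i, T (J + i) ^ θ) ^ (m - 1) *
      (c * ∫⁻ x in Metric.ball xc (2 * ρ), f x)) Filter.atTop (nhds 0) := by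
    have h0 := ENNReal.tendsto_sum_nat_add (fun j => T j ^ θ) hT
    simp only [add_comm _ (_ : ℕ)] at h0
    have h1 := ((ENNReal.continuous_pow (m - 1)).tendsto 0).comp h0
    have h2 := ENNReal.Tendsto.const_mul (a := 2 * A ^ 2) h1
      (.inr (ENNReal.mul_ne_top (by simp) (ENNReal.pow_ne_top hAt)))
    have h3 := ENNReal.Tendsto.mul_const (b := c * ∫⁻ x in Metric.ball xc (2 * ρ), f x) h2
      (.inr (ENNReal.mul_ne_top hct hΨ))
    rw [zero_pow (by omega), mul_zero, zero_mul] at h3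
    exact h3
  obtain ⟨J, hJ⟩ := (hlim.eventually (gt_mem_nhds (pos_iff_ne_zero.2 hVm0))).exists
  refine ⟨A ^ (J + 4), ENNReal.pow_ne_top hAt, fun x hxx y hyy => ?_⟩
  by_contra hlt
  exact absurd (outer J x hxx y hyy (not_le.1 hlt).le) (not_le.2 hJ)

/-! ### Truncations and passage to `[0, ∞]`-valued functions -/

theorem uTrunc_zero (t : EReal) : uTrunc 0 t = uPlus t := by simp [uTrunc, uPlus]

theorem uPlus_nonneg (t : EReal) : 0 ≤ uPlus t := EReal.toReal_nonneg (le_max_right _ _)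

theorem uTrunc_nonneg {M : ℝ} (hM : 0 ≤ M) (t : EReal) : 0 ≤ uTrunc M t := by
  unfold uTrunc
  -- As `EReal.toReal ⊤ = 0`, the truncation at `⊤` is `M`, still nonnegative.
  rcases eq_or_ne t ⊤ with rfl | ht
  · simpa using hM
  · have h : max t ((-M : ℝ) : EReal) ≠ ⊤ := by
      rw [← lt_top_iff_ne_top]; exact max_lt (lt_top_iff_ne_top.2 ht) (EReal.coe_lt_top _)
    have := EReal.toReal_le_toReal (le_max_right t ((-M : ℝ) : EReal)) (EReal.coe_ne_bot _) h
    rw [EReal.toReal_coe] at this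
    linarith

theorem uTrunc_le {M : ℝ} (hM : 0 ≤ M) (t : EReal) : uTrunc M t ≤ uPlus t + M := by
  unfold uTrunc uPlus
  rcases eq_or_ne t ⊤ with rfl | ht
  · simp
  · have h : max t 0 ≠ ⊤ := by
      rw [← lt_top_iff_ne_top]; exact max_lt (lt_top_iff_ne_top.2 ht) EReal.zero_lt_top
    have hb : max t ((-M : ℝ) : EReal) ≠ ⊥ :=
      (lt_of_lt_of_le (EReal.bot_lt_coe _) (le_max_right _ _)).ne'
    have := EReal.toReal_le_toReal (max_le_max le_rfl
      (show ((-M : ℝ) : EReal) ≤ 0 by exact_mod_cast (neg_nonpos.2 hM))) hb h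
    linarith

theorem measurable_uPlus : Measurable uPlus :=
  measurable_ereal_toReal.comp (measurable_id.max measurable_const)

theorem measurable_uTrunc (M : ℝ) : Measurable (uTrunc M) :=
  (measurable_ereal_toReal.comp (measurable_id.max measurable_const)).add_const M

theorem integrableOn_uTrunc {N : ℕ} {u : EuclideanSpace ℝ (Fin N) → EReal}
    {D k : Set (EuclideanSpace ℝ (Fin N))} (hu : NullMeasurable u (volume.restrict D))
    (hint : LocallyIntegrableOn (fun x => uPlus (u x)) D volume) (hk : IsCompact k) (hkD : k ⊆ D)
    {M : ℝ} (hM : 0 ≤ M) : IntegrableOn (fun x => uTrunc M (u x)) k := by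
  have h1 : IntegrableOn (fun x => uPlus (u x) + M) k :=
    (hint.integrableOn_compact_subset hkD hk).add (integrableOn_const hk.measure_lt_top.ne)
  have h2 : AEMeasurable u (volume.restrict k) :=
    hu.aemeasurable.mono_measure (Measure.restrict_mono hkD le_rfl)
  refine h1.mono' ((measurable_uTrunc M).comp_aemeasurable h2).aestronglyMeasurable
    (.of_forall fun x => ?_)
  rw [Real.norm_of_nonneg (uTrunc_nonneg hM _)]
  exact uTrunc_le hM _

/-- Integrability is not needed: a non-integrable function has Bochner integral `0`. -/
theorem ofReal_integral_le_lintegral_ofReal {α : Type*} [MeasurableSpace α] {μ : Measure α}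
    {f : α → ℝ} (hf : ∀ x, 0 ≤ f x) :
    ENNReal.ofReal (∫ x, f x ∂μ) ≤ ∫⁻ x, ENNReal.ofReal (f x) ∂μ := by
  by_cases h : Integrable f μ
  · exact (ofReal_integral_eq_lintegral_ofReal h (.of_forall hf)).le
  · simp [integral_undef h]

theorem ofReal_volume_unitBall_mul_pow {N : ℕ} (x : EuclideanSpace ℝ (Fin N)) {r : ℝ}
    (hr : 0 < r) :
    ENNReal.ofReal (volume.real (Metric.ball (0 : EuclideanSpace ℝ (Fin N)) 1) * r ^ N) =
      volume (Metric.ball x r) := by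
  rw [volume_ball_eq_ofReal_pow_mul x hr, ENNReal.ofReal_mul measureReal_nonneg,
    ofReal_measureReal measure_ball_lt_top.ne, ENNReal.ofReal_pow hr.le, mul_comm]

theorem IsKQuasiNearlySubharmonic.subMeanValue {N : ℕ} {K : ℝ}
    {u : EuclideanSpace ℝ (Fin N) → EReal} {D : Set (EuclideanSpace ℝ (Fin N))}
    (h : IsKQuasiNearlySubharmonic K u D) {M : ℝ} (hM : 0 ≤ M) :
    SubMeanValue (ENNReal.ofReal K) (fun x => ENNReal.ofReal (uTrunc M (u x))) D := by
  intro x r hr hx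
  have h1 := h.mean_value x r hr hx M hM
  set V := volume.real (Metric.ball (0 : EuclideanSpace ℝ (Fin N)) 1) * r ^ N with hV
  have hVpos : 0 < V := by
    refine mul_pos (ENNReal.toReal_pos (Metric.measure_ball_pos _ _ one_pos).ne'
      measure_ball_lt_top.ne) (by positivity)
  rw [div_mul_eq_mul_div, le_div_iff₀ hVpos] at h1
  rw [← ofReal_volume_unitBall_mul_pow x hr, ← hV, ← ENNReal.ofReal_mul (uTrunc_nonneg hM _)]
  refine (ENNReal.ofReal_le_ofReal h1).trans ?_
  rw [ENNReal.ofReal_mul (zero_le_one.trans h.one_le)]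
  gcongr
  exact ofReal_integral_le_lintegral_ofReal fun y => uTrunc_nonneg hM _

theorem IsKQuasiNearlySubharmonic.exists_bound {N : ℕ} {K : ℝ}
    {u : EuclideanSpace ℝ (Fin N) → EReal} {D : Set (EuclideanSpace ℝ (Fin N))}
    (h : IsKQuasiNearlySubharmonic K u D) {x₀ : EuclideanSpace ℝ (Fin N)} {R R' : ℝ} (hR : R < R')
    (hD : Metric.closedBall x₀ R' ⊆ D) :
    ∃ C : ℝ≥0∞, C ≠ ∞ ∧ ∀ x ∈ Metric.ball x₀ R, ENNReal.ofReal (uTrunc 0 (u x)) ≤ C := by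
  refine (h.subMeanValue le_rfl).exists_bound ENNReal.ofReal_ne_top hR hD ?_
  have h1 := integrableOn_uTrunc h.measurable h.locallyIntegrable
    (isCompact_closedBall x₀ R') hD le_rfl
  have h2 := (hasFiniteIntegral_iff_ofReal (.of_forall fun x => uTrunc_nonneg le_rfl _)).1 h1.2
  exact h2.ne

theorem aemeasurable_ofReal_uTrunc {N : ℕ} {u : EuclideanSpace ℝ (Fin N) → EReal}
    {D D' : Set (EuclideanSpace ℝ (Fin N))} (hu : NullMeasurable u (volume.restrict D))
    (hD : D' ⊆ D) (M : ℝ) :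
    AEMeasurable (fun x => ENNReal.ofReal (uTrunc M (u x))) (volume.restrict D') :=
  (measurable_uTrunc M).ennreal_ofReal.comp_aemeasurable
    (hu.aemeasurable.mono_measure (Measure.restrict_mono hD le_rfl))

/-- Since `4K ≥ 4 > e`, the level condition gives `log t ≥ i + 2`, while the weight to the power `p
- 1` is `1 / φ(i+2)`; monotonicity of `φ` finishes. -/
theorem one_le_weight_mul {p : ℕ} (hp : 2 ≤ p) {φ : ℝ → ℝ} (hmono : MonotoneOn φ (Ici 0))
    (hpos : ∀ s, 0 < s → 0 < φ s) {K : ℝ} (hK : 1 ≤ K) {i : ℕ} {t : ℝ}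
    (ht : (4 * ENNReal.ofReal K) ^ (i + 2) ≤ ENNReal.ofReal t) :
    1 ≤ ENNReal.ofReal (φ ((i : ℝ) + 2) ^ (-(1 / ((p : ℝ) - 1)))) ^ (p - 1) *
      ENNReal.ofReal (φ (Real.posLog t)) := by
  have hi : (0 : ℝ) < i + 2 := by positivity
  have h4 : (4 : ℝ) ^ (i + 2) ≤ t := by
    have h1 : ENNReal.ofReal ((4 * K) ^ (i + 2)) ≤ ENNReal.ofReal t := by
      rwa [ENNReal.ofReal_pow (by positivity), ENNReal.ofReal_mul (by norm_num),
        ENNReal.ofReal_ofNat]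
    have h2 : (0 : ℝ) < (4 * K) ^ (i + 2) := by positivity
    have h3 : (4 * K) ^ (i + 2) ≤ t :=
      (ENNReal.ofReal_le_ofReal_iff' .. |>.1 h1).resolve_right (not_le.2 h2)
    refine le_trans ?_ h3
    gcongr
    linarith
  have hexp : Real.exp ((i : ℝ) + 2) ≤ t := by
    refine le_trans ?_ h4
    have : ((i : ℝ) + 2) = ((i + 2 : ℕ) : ℝ) * 1 := by push_cast; ring
    rw [this, Real.exp_nat_mul]
    gcongr
    linarith [Real.exp_one_lt_d9]
  have ht0 : 0 < t := (Real.exp_pos _).trans_le hexp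
  have hlog : (i : ℝ) + 2 ≤ Real.posLog t :=
    ((Real.le_log_iff_exp_le ht0).2 hexp).trans (le_max_right _ _)
  have hφ : φ ((i : ℝ) + 2) ≤ φ (Real.posLog t) :=
    hmono hi.le (hi.le.trans hlog) hlog
  have hφ0 := hpos _ hi
  have hp' : (p : ℝ) - 1 = ((p - 1 : ℕ) : ℝ) := by rw [Nat.cast_sub (by omega)]; simp
  rw [← ENNReal.ofReal_pow (by positivity), ← ENNReal.ofReal_mul (by positivity),
    ← ENNReal.ofReal_one]
  refine ENNReal.ofReal_le_ofReal ?_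
  rw [hp', one_div, Real.rpow_neg hφ0.le, inv_pow, Real.rpow_inv_natCast_pow hφ0.le (by omega),
    inv_mul_eq_div, one_le_div hφ0]
  exact hφ

/-- Local boundedness implies local integrability of `u⁺`. -/
theorem locallyIntegrableOn_uPlus {N : ℕ} {u : EuclideanSpace ℝ (Fin N) → EReal}
    {D : Set (EuclideanSpace ℝ (Fin N))} (hu : NullMeasurable u (volume.restrict D))
    (hb : ∀ z ∈ D, ∃ ε > 0, ∃ C : ℝ≥0∞, C ≠ ∞ ∧ Metric.ball z ε ⊆ D ∧
      ∀ x ∈ Metric.ball z ε, ENNReal.ofReal (uTrunc 0 (u x)) ≤ C) :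
    LocallyIntegrableOn (fun x => uPlus (u x)) D volume := by
  intro z hz
  obtain ⟨ε, hε, C, hC, hD, hle⟩ := hb z hz
  refine ⟨Metric.ball z ε, mem_nhdsWithin_of_mem_nhds (Metric.ball_mem_nhds z hε), ?_⟩
  refine IntegrableOn.of_bound (C := C.toReal) measure_ball_lt_top
    (measurable_uPlus.comp_aemeasurable (hu.aemeasurable.mono_measure
      (Measure.restrict_mono hD le_rfl))).aestronglyMeasurable ?_
  filter_upwards [ae_restrict_mem measurableSet_ball] with x hx
  rw [Real.norm_of_nonneg (uPlus_nonneg _), ← uTrunc_zero]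
  exact (ENNReal.ofReal_le_iff_le_toReal hC).1 (hle x hx)

/-! ### From separate to joint mean value inequalities -/

/-- Iterating the mean value inequalities in the two variables. -/
theorem mul_volume_mul_volume_le {m n : ℕ} {K : ℝ≥0∞} (hK : K ≠ ∞)
    {w : EuclideanSpace ℝ (Fin (m + n)) → ℝ≥0∞} {D : Set (EuclideanSpace ℝ (Fin (m + n)))}
    (hx : ∀ y, SubMeanValue K (fun x => w (joinPt x y)) {x | joinPt x y ∈ D})
    (hy : ∀ x, SubMeanValue K (fun y => w (joinPt x y)) {y | joinPt x y ∈ D})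
    {x : EuclideanSpace ℝ (Fin m)} {y : EuclideanSpace ℝ (Fin n)} {r : ℝ} (hr : 0 < r)
    (hD : Metric.closedBall (joinPt x y) r ⊆ D)
    (hw : AEMeasurable w (volume.restrict (Metric.ball (joinPt x y) r))) :
    w (joinPt x y) * volume (Metric.ball x (r / 2)) * volume (Metric.ball y (r / 2)) ≤
      K ^ 2 * ∫⁻ z in Metric.ball (joinPt x y) r, w z := by
  have hr2 : 0 < r / 2 := by positivity
  -- Radii `r / 2` suffice because `‖(x, y)‖ ≤ ‖x‖ + ‖y‖`.
  have hsub : ∀ x' ∈ Metric.closedBall x (r / 2), ∀ y' ∈ Metric.closedBall y (r / 2),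
      joinPt x' y' ∈ D := by
    intro x' hx' y' hy'
    refine hD ((dist_joinPt_le _ _ _ _).trans ?_)
    rw [Metric.mem_closedBall] at hx' hy'
    linarith
  have h1 := hx y x (r / 2) hr2 fun x' hx' =>
    hsub x' hx' y (Metric.mem_closedBall_self hr2.le)
  set V := volume (Metric.ball y (r / 2)) with hV
  have hVt : V ≠ ∞ := measure_ball_lt_top.ne
  calc _ ≤ (K * ∫⁻ x' in Metric.ball x (r / 2), w (joinPt x' y)) * V := by gcongr
    _ = K * ∫⁻ x' in Metric.ball x (r / 2), w (joinPt x' y) * V := by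
      rw [lintegral_mul_const' _ _ hVt, mul_assoc]
    _ ≤ K * ∫⁻ x' in Metric.ball x (r / 2),
          K * ∫⁻ y' in Metric.ball y (r / 2), w (joinPt x' y') := by
      gcongr K * ?_
      refine setLIntegral_mono' measurableSet_ball fun x' hx' => ?_
      exact hy x' y (r / 2) hr2 fun y' hy' => hsub x' (Metric.ball_subset_closedBall hx') y' hy'
    _ = K ^ 2 * ∫⁻ x' in Metric.ball x (r / 2),
          ∫⁻ y' in Metric.ball y (r / 2), w (joinPt x' y') := by
      rw [lintegral_const_mul' _ _ hK]; ring
    _ ≤ _ := by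
      gcongr K ^ 2 * ?_
      refine lintegral_lintegral_joinPt_le hw fun x' hx' y' hy' => ?_
      refine (dist_joinPt_le _ _ _ _).trans_lt ?_
      rw [Metric.mem_ball] at hx' hy'
      linarith

/-- A function which is quasi-nearly subharmonic in each variable and has locally integrable
positive part is quasi-nearly subharmonic. -/
theorem isQuasiNearlySubharmonic_of_separately {m n : ℕ} {K : ℝ}
    {Ω : Set (EuclideanSpace ℝ (Fin (m + n)))}
    {u : EuclideanSpace ℝ (Fin (m + n)) → EReal} (hu_top : ∀ z ∈ Ω, u z < ⊤)
    (hu_meas : NullMeasurable u (volume.restrict Ω))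
    (ha : ∀ y : EuclideanSpace ℝ (Fin n),
      IsKQuasiNearlySubharmonic K (fun x : EuclideanSpace ℝ (Fin m) => u (joinPt x y))
        {x | joinPt x y ∈ Ω})
    (hb : ∀ x : EuclideanSpace ℝ (Fin m),
      IsKQuasiNearlySubharmonic K (fun y : EuclideanSpace ℝ (Fin n) => u (joinPt x y))
        {y | joinPt x y ∈ Ω})
    (hint : LocallyIntegrableOn (fun x => uPlus (u x)) Ω volume) :
    IsQuasiNearlySubharmonic u Ω := by
  set νm := volume.real (Metric.ball (0 : EuclideanSpace ℝ (Fin m)) 1) with hνm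
  set νn := volume.real (Metric.ball (0 : EuclideanSpace ℝ (Fin n)) 1) with hνn
  set ν := volume.real (Metric.ball (0 : EuclideanSpace ℝ (Fin (m + n))) 1) with hν
  have hνm0 : 0 < νm := ENNReal.toReal_pos (Metric.measure_ball_pos _ _ one_pos).ne'
    measure_ball_lt_top.ne
  have hνn0 : 0 < νn := ENNReal.toReal_pos (Metric.measure_ball_pos _ _ one_pos).ne'
    measure_ball_lt_top.ne
  have hν0 : 0 < ν := ENNReal.toReal_pos (Metric.measure_ball_pos _ _ one_pos).ne'
    measure_ball_lt_top.ne
  have hK0 : 0 ≤ K := zero_le_one.trans (ha 0).one_le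
  -- `K²` comes from two mean value inequalities, the rest is the volume ratio of the `r`-ball to a
  -- product of `r/2`-balls.
  refine ⟨max 1 (K ^ 2 * 2 ^ (m + n) * ν / (νm * νn)), le_max_left _ _, hu_top, hu_meas, hint, ?_⟩
  intro z r hr hz M hM
  obtain ⟨x, y, rfl⟩ := exists_eq_joinPt z
  have hball : Metric.ball (joinPt x y) r ⊆ Ω := Metric.ball_subset_closedBall.trans hz
  have h1 := mul_volume_mul_volume_le ENNReal.ofReal_ne_top
    (w := fun z => ENNReal.ofReal (uTrunc M (u z)))
    (fun y => (ha y).subMeanValue hM) (fun x => (hb x).subMeanValue hM) hr hz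
    (aemeasurable_ofReal_uTrunc hu_meas hball M)
  have hI : IntegrableOn (fun z => uTrunc M (u z)) (Metric.ball (joinPt x y) r) :=
    (integrableOn_uTrunc hu_meas hint (isCompact_closedBall _ _) hz hM).mono_set
      Metric.ball_subset_closedBall
  set I := ∫ z in Metric.ball (joinPt x y) r, uTrunc M (u z) with hIdef
  have hI0 : 0 ≤ I := integral_nonneg fun z => uTrunc_nonneg hM _
  rw [← ofReal_integral_eq_lintegral_ofReal hI (.of_forall fun z => uTrunc_nonneg hM _),
    ← ofReal_volume_unitBall_mul_pow x (half_pos hr),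
    ← ofReal_volume_unitBall_mul_pow y (half_pos hr),
    ← ENNReal.ofReal_mul (uTrunc_nonneg hM _), ← ENNReal.ofReal_mul
      (mul_nonneg (uTrunc_nonneg hM _) (by positivity)), ← ENNReal.ofReal_pow hK0,
    ← ENNReal.ofReal_mul (by positivity), ENNReal.ofReal_le_ofReal_iff (by positivity)] at h1
  calc uTrunc M (u (joinPt x y))
      ≤ K ^ 2 * I / (νm * (r / 2) ^ m * (νn * (r / 2) ^ n)) := by
        rw [le_div_iff₀ (by positivity), ← mul_assoc]
        exact h1
    _ = (K ^ 2 * 2 ^ (m + n) * ν / (νm * νn)) / (ν * r ^ (m + n)) * I := by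
        rw [div_pow, div_pow, pow_add, pow_add]
        field_simp
    _ ≤ _ := by
        gcongr
        exact le_max_right _ _

/-! ### Proof of the main theorem -/

theorem corollary4p3 (m n : ℕ) (hn : 2 ≤ n) (hmn : n ≤ m) (K : ℝ) (hK : 1 ≤ K)
    (Ω : Set (EuclideanSpace ℝ (Fin (m + n)))) (hΩ : IsOpen Ω) (hΩc : IsConnected Ω)
    (u : EuclideanSpace ℝ (Fin (m + n)) → EReal) (hu_top : ∀ z ∈ Ω, u z < ⊤)
    (hu_meas : NullMeasurable u (volume.restrict Ω))
    (ha : ∀ y : EuclideanSpace ℝ (Fin n),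
      IsKQuasiNearlySubharmonic K (fun x : EuclideanSpace ℝ (Fin m) => u (joinPt x y))
        {x | joinPt x y ∈ Ω})
    (hb : ∀ x : EuclideanSpace ℝ (Fin m),
      IsKQuasiNearlySubharmonic K (fun y : EuclideanSpace ℝ (Fin n) => u (joinPt x y))
        {y | joinPt x y ∈ Ω})
    (hc : ∃ φ : ℝ → ℝ, StrictMonoOn φ (Ici 0) ∧ φ '' Ici 0 = Ici 0 ∧
      (∃ s₀ : ℕ, IntegrableOn
        (fun s : ℝ => s ^ (((n : ℝ) - 1) / ((m : ℝ) - 1)) / φ (s - s₀) ^ (1 / ((m : ℝ) - 1)))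
        (Ioi ((s₀ : ℝ) + 1)) volume) ∧
      LocallyIntegrableOn (fun z => φ (Real.posLog (uPlus (u z)))) Ω volume) :
    IsQuasiNearlySubharmonic u Ω := by
  obtain ⟨φ, hφmono, hφim, ⟨s₀, hs₀⟩, hφint⟩ := hc
  have hφnn : ∀ s, 0 ≤ s → 0 ≤ φ s := fun s hs => by
    have : φ s ∈ φ '' Ici 0 := mem_image_of_mem φ hs
    rwa [hφim] at this
  have hφpos : ∀ s, 0 < s → 0 < φ s := fun s hs =>
    (hφnn 0 le_rfl).trans_lt (hφmono (le_refl (0 : ℝ)) hs.le hs)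
  have hn1 : (0 : ℝ) < (n : ℝ) - 1 := by
    have : (2 : ℝ) ≤ n := by exact_mod_cast hn
    linarith
  have hnm1 : (n : ℝ) - 1 ≤ (m : ℝ) - 1 := by
    have : (n : ℝ) ≤ m := by exact_mod_cast hmn
    linarith
  have hT := tsum_tail_rpow_ne_top hn1 hnm1 hφmono.monotoneOn hφpos s₀ hs₀
  refine isQuasiNearlySubharmonic_of_separately hu_top hu_meas ha hb
    (locallyIntegrableOn_uPlus hu_meas fun z hz => ?_)
  obtain ⟨ε, hε, hεΩ⟩ := Metric.nhds_basis_closedBall.mem_iff.1 (hΩ.mem_nhds hz)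
  obtain ⟨xc, yc, rfl⟩ := exists_eq_joinPt z
  -- Balls of radius `3ρ = ε/2` in the factors have product inside the `ε`-ball. The gap between
  -- `2ρ` and `3ρ` makes each slice bounded on the `2ρ`-balls; the uniform bound holds on the
  -- `ρ`-balls.
  set ρ := ε / 6 with hρdef
  have hρ : 0 < ρ := by positivity
  have hrect : ∀ x ∈ Metric.closedBall xc (3 * ρ), ∀ y ∈ Metric.closedBall yc (3 * ρ),
      joinPt x y ∈ Metric.closedBall (joinPt xc yc) ε := by
    intro x hx y hy
    refine (dist_joinPt_le _ _ _ _).trans ?_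
    rw [Metric.mem_closedBall] at hx hy
    linarith
  have hρ2 : ∀ {N : ℕ} (c : EuclideanSpace ℝ (Fin N)),
      Metric.ball c (2 * ρ) ⊆ Metric.closedBall c (3 * ρ) := fun c =>
    Metric.ball_subset_closedBall.trans (Metric.closedBall_subset_closedBall (by linarith))
  have hx3 : ∀ y ∈ Metric.ball yc (2 * ρ),
      Metric.closedBall xc (3 * ρ) ⊆ {x | joinPt x y ∈ Ω} := fun y hy x hx =>
    hεΩ (hrect x hx y (hρ2 yc hy))
  have hy3 : ∀ x ∈ Metric.ball xc (2 * ρ),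
      Metric.closedBall yc (3 * ρ) ⊆ {y | joinPt x y ∈ Ω} := fun x hx y hy =>
    hεΩ (hrect x (hρ2 xc hx) y hy)
  have hΨint := hφint.integrableOn_compact_subset hεΩ (isCompact_closedBall _ _)
  have hΨfin := (hasFiniteIntegral_iff_ofReal
    (.of_forall fun z => hφnn _ (Real.posLog_nonneg (x := uPlus (u z))))).1 hΨint.2
  obtain ⟨C, hC, hle⟩ := exists_bound_of_separate_subMeanValue (hn.trans hmn) hn
    (K := ENNReal.ofReal K) (by simpa using hK) ENNReal.ofReal_ne_top
    (v := fun z => ENNReal.ofReal (uTrunc 0 (u z)))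
    (Ψ := fun z => ENNReal.ofReal (φ (Real.posLog (uPlus (u z))))) (xc := xc) (yc := yc) hρ
    (fun y hy => ((ha y).subMeanValue le_rfl).mono ((hρ2 xc).trans (hx3 y hy)))
    (fun y hy => aemeasurable_ofReal_uTrunc (ha y).measurable ((hρ2 xc).trans (hx3 y hy)) 0)
    (fun y hy => (ha y).exists_bound (by linarith) (hx3 y hy))
    (fun x hx => ((hb x).subMeanValue le_rfl).mono ((hρ2 yc).trans (hy3 x hx)))
    (fun x hx => aemeasurable_ofReal_uTrunc (hb x).measurable ((hρ2 yc).trans (hy3 x hx)) 0)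
    (fun x hx => (hb x).exists_bound (by linarith) (hy3 x hx))
    (ne_top_of_le_ne_top hΨfin.ne (lintegral_lintegral_joinPt_le
      hΨint.aestronglyMeasurable.aemeasurable.ennreal_ofReal
      fun x hx y hy => hrect x (hρ2 xc hx) y (hρ2 yc hy)))
    (a := fun i => ENNReal.ofReal (φ ((i : ℝ) + 2) ^ (-(1 / ((n : ℝ) - 1)))))
    (fun i => ENNReal.ofReal_ne_top)
    (fun i x _ y _ hv => one_le_weight_mul hn hφmono.monotoneOn hφpos hK
      (by simpa only [uTrunc_zero] using hv)) hT
  refine ⟨ρ, hρ, C, hC, (Metric.ball_subset_closedBall.trans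
    (Metric.closedBall_subset_closedBall (by linarith))).trans hεΩ, fun z hz => ?_⟩
  obtain ⟨x, y, rfl⟩ := exists_eq_joinPt z
  have hd := dist_le_dist_joinPt x xc y yc
  exact hle x (hd.1.trans_lt hz) y (hd.2.trans_lt hz)
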